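/- Let $R$ be a noetherian local ring with maximal ideal $\mathfrak m_R$ whose formal completion $\hat R=\varprojlim_n R/\mathfrak m_R^n$ is a normal (integrally closed) domain, and let $p\ge 1$ be the characteristic exponent of $\operatorname{Frac}(R)$ (so $p=1$ in characteristic $0$). Let $$R^{\mathrm{prc}}=\{b\in\hat R \mid b^{p^\nu}\in R \text{ for some } \nu\ge 0\}$$ be the $p$-radical closure of $R$; it is a local ring and $R\subset R^{\mathrm{prc}}$ is a local homomorphism. Let $(A_\lambda)_{\lambda\in L}$ be the system of all $R$-subalgebras of $R^{\mathrm{prc}}$ that are finitely generated as $R$-modules, where $L$ is ordered by inclusion of the $A_\lambda$, and let $R_\lambda$ be the normalization of $A_\lambda$, that is, the integral closure of $A_\lambda$ in $\operatorname{Frac}(A_\lambda)$; it is a local ring. For a local ring $B$ with completion $\hat B=\varprojlim_n B/\mathfrak m_B^n$, the formal fiber rings are $\hat B\otimes_B\kappa(\mathfrak p)$ for prime ideals $\mathfrak p\subset B$; the generic ones are those with $\mathfrak p$ minimal. Let $L'\subset L$ be the subset of all $\lambda$ such that $R_\lambda$ is noetherian and its generic formal fiber is reduced. Suppose that all formal fibers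 of $R$ are reduced and that $L'$ is cofinal in $L$. Then the local ring $R^{\mathrm{prc}}$ is noetherian, its generic formal fiber is reduced, the extension $R\subset R^{\mathrm{prc}}$ is faithfully flat with ramification index $e=\operatorname{length}_{R^{\mathrm{prc}}}(R^{\mathrm{prc}}/\mathfrak m_R R^{\mathrm{prc}})=1$ and residual degree $f=[\kappa(R^{\mathrm{prc}}):\kappa(R)]=1$, and the canonical map $\hat R\to\widehat{R^{\mathrm{prc}}}$ is bijective. -/

import Mathlib

open IsLocalRing

noncomputable section

namespace PRadical

universe u

/-! ### Formal completions and formal fibres of local rings -/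

/-- The formal completion `lim R / 𝔪ⁿ` of a local ring `R` (not assumed noetherian). -/
abbrev FormalCompletion (R : Type u) [CommRing R] [IsLocalRing R] : Type u :=
  AdicCompletion (maximalIdeal R) R

/-- A local homomorphism maps `𝔪_R ^ n` into `𝔪_A ^ n`. -/
theorem maximalIdeal_pow_le_comap {R A : Type u} [CommRing R] [IsLocalRing R] [CommRing A]
    [IsLocalRing A] (φ : R →+* A) [IsLocalHom φ] (n : ℕ) :
    maximalIdeal R ^ n ≤ (maximalIdeal A ^ n).comap φ := by
  rw [← Ideal.map_le_iff_le_comap, Ideal.map_pow]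
  exact Ideal.pow_right_mono (((local_hom_TFAE φ).out 0 2).mp ‹IsLocalHom φ›) n

/-- The map `R̂ → Â` on formal completions induced by a local homomorphism `φ : R → A`: it is the
limit of the maps `R / 𝔪_R ^ n → A / 𝔪_A ^ n`. -/
def formalCompletionMap {R A : Type u} [CommRing R] [IsLocalRing R] [CommRing A]
    [IsLocalRing A] (φ : R →+* A) [IsLocalHom φ] :
    FormalCompletion R →+* FormalCompletion A :=
  AdicCompletion.liftRingHom (maximalIdeal A)
    (fun n ↦ (Ideal.quotientMap (maximalIdeal A ^ n) φ (maximalIdeal_pow_le_comap φ n)).comp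
      (AdicCompletion.evalₐ (maximalIdeal R) n).toRingHom)
    (by
      intro m n hle
      ext x
      obtain ⟨y, rfl⟩ := AdicCompletion.mk_surjective (maximalIdeal R) R x
      have h := AdicCompletion.Ideal.mk_eq_mk (maximalIdeal R) hle y
      have h2 := congrArg
        (Ideal.quotientMap (maximalIdeal A ^ m) φ (maximalIdeal_pow_le_comap φ m)) h
      simpa using h2)

/-- All formal fibre rings `κ(𝔭) ⊗ R̂` of `R`, for `𝔭` a prime ideal of `R`, are reduced. -/
def HasReducedFormalFibers (R : Type u) [CommRing R] [IsLocalRing R] : Prop :=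
  ∀ (q : Ideal R) [q.IsPrime], IsReduced (q.Fiber (FormalCompletion R))

/-- The generic formal fibre rings `κ(𝔭) ⊗ R̂` of `R`, for `𝔭` a minimal prime ideal of `R`,
are reduced. -/
def HasReducedGenericFormalFiber (R : Type u) [CommRing R] [IsLocalRing R] : Prop :=
  ∀ (q : Ideal R) [q.IsPrime], q ∈ minimalPrimes R → IsReduced (q.Fiber (FormalCompletion R))

/-! ### Numerical invariants of an extension of local rings -/

/-- The ramification index `e = length_A (A / 𝔪_R A)`. -/
def ramificationIndex (R A : Type u) [CommRing R] [IsLocalRing R] [CommRing A] [Algebra R A] :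
    ℕ∞ :=
  Module.length A (A ⧸ (maximalIdeal R).map (algebraMap R A))

/-- The residual degree `f = [κ(A) : κ(R)]`. -/
def residualDegree (R A : Type u) [CommRing R] [IsLocalRing R] [CommRing A] [IsLocalRing A]
    [Algebra R A] [IsLocalHom (algebraMap R A)] : ℕ∞ :=
  Cardinal.toENat (Module.rank (ResidueField R) (ResidueField A))

/-! ### The `p`-radical closure -/

/-- If every element of `B` has a power coming from the local ring `R`, then `B` is local. -/
theorem isLocalRing_of_pow_mem_range {R B : Type u} [CommRing R] [IsLocalRing R] [CommRing B]
    [Nontrivial B] [Algebra R B]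
    (h : ∀ b : B, ∃ n : ℕ, 0 < n ∧ ∃ r : R, algebraMap R B r = b ^ n) : IsLocalRing B := by
  have : Algebra.IsIntegral R B := ⟨fun b ↦ by
    obtain ⟨n, hn, r, hr⟩ := h b
    exact IsIntegral.of_pow hn (hr ▸ isIntegral_algebraMap)⟩
  have key : ∀ M N : Ideal B, M.IsMaximal → N.IsMaximal → M ≤ N := by
    intro M N hM hN b hb
    obtain ⟨n, hn, r, hr⟩ := h b
    have h1 := eq_maximalIdeal (Ideal.isMaximal_comap_of_isIntegral_of_isMaximal (R := R) M)
    have h2 := eq_maximalIdeal (Ideal.isMaximal_comap_of_isIntegral_of_isMaximal (R := R) N)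
    have hr1 : r ∈ M.comap (algebraMap R B) := by
      rw [Ideal.mem_comap, hr]
      exact Ideal.pow_mem_of_mem M hb n hn
    rw [h1, ← h2, Ideal.mem_comap, hr] at hr1
    exact hN.isPrime.mem_of_pow_mem n hr1
  obtain ⟨M, hM⟩ := Ideal.exists_maximal B
  exact IsLocalRing.of_unique_max_ideal
    ⟨M, hM, fun N hN ↦ le_antisymm (key N M hN hM) (key M N hM hN)⟩

section

variable (R : Type u) [CommRing R] [IsLocalRing R] [IsNoetherianRing R]

theorem algebraMap_formalCompletion_injective :
    Function.Injective (algebraMap R (FormalCompletion R)) :=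
  AdicCompletion.of_injective (maximalIdeal R) R

/-! From here on, `R` is formally integral, that is, `R̂` is a domain. -/

variable [IsDomain (FormalCompletion R)]

theorem isDomain_of_formalCompletion : IsDomain R :=
  (algebraMap_formalCompletion_injective R).isDomain

/-- The characteristic exponent of the field of fractions of `R`. -/
def charExponent : ℕ := ringExpChar (FractionRing R)

theorem expChar_formalCompletion : ExpChar (FormalCompletion R) (charExponent R) := by
  have := isDomain_of_formalCompletion R
  have h1 : ExpChar (FractionRing R) (charExponent R) := ringExpChar.expChar _
  have h2 : ExpChar R (charExponent R) :=
    ((algebraMap R (FractionRing R)).expChar_iff (IsFractionRing.injective R _) _).mpr h1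
  exact expChar_of_injective_algebraMap (algebraMap_formalCompletion_injective R) _

/-- The `p`-radical closure `{b ∈ R̂ | b ^ (p ^ ν) ∈ R for some ν ≥ 0}` of a formally integral
noetherian local ring `R`, where `p` is the characteristic exponent of `Frac R`. -/
def pRadicalClosure : Subalgebra R (FormalCompletion R) where
  carrier := {b | ∃ (ν : ℕ) (r : R),
    algebraMap R (FormalCompletion R) r = b ^ charExponent R ^ ν}
  mul_mem' := by
    rintro a b ⟨m, r, hr⟩ ⟨n, s, hs⟩
    refine ⟨m + n, r ^ charExponent R ^ n * s ^ charExponent R ^ m, ?_⟩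
    rw [map_mul, map_pow, map_pow, hr, hs, mul_pow, pow_add, ← pow_mul, ← pow_mul, mul_comm
      (charExponent R ^ n) (charExponent R ^ m)]
  add_mem' := by
    rintro a b ⟨m, r, hr⟩ ⟨n, s, hs⟩
    have := expChar_formalCompletion R
    refine ⟨m + n, r ^ charExponent R ^ n + s ^ charExponent R ^ m, ?_⟩
    rw [map_add, map_pow, map_pow, hr, hs, add_pow_expChar_pow, pow_add, ← pow_mul, ← pow_mul,
      mul_comm (charExponent R ^ n) (charExponent R ^ m)]
  algebraMap_mem' r := ⟨0, r, by simp⟩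

theorem charExponent_pow_pos (ν : ℕ) : 0 < charExponent R ^ ν := by
  have := expChar_formalCompletion R
  exact expChar_pow_pos (FormalCompletion R) _ ν

theorem exists_pow_eq_algebraMap (b : pRadicalClosure R) :
    ∃ (ν : ℕ) (r : R), algebraMap R (pRadicalClosure R) r = b ^ charExponent R ^ ν := by
  obtain ⟨ν, r, hr⟩ := b.2
  exact ⟨ν, r, Subtype.ext hr⟩

instance instIsLocalRingPRadicalClosure : IsLocalRing (pRadicalClosure R) :=
  isLocalRing_of_pow_mem_range (R := R) fun b ↦ by
    obtain ⟨ν, r, hr⟩ := exists_pow_eq_algebraMap R b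
    exact ⟨_, charExponent_pow_pos R ν, r, hr⟩

theorem algebraMap_pRadicalClosure_injective :
    Function.Injective (algebraMap R (pRadicalClosure R)) := fun _ _ h ↦
  algebraMap_formalCompletion_injective R (congrArg Subtype.val h)

instance instIsLocalHomPRadicalClosure : IsLocalHom (algebraMap R (pRadicalClosure R)) := by
  refine RingHom.IsIntegral.isLocalHom (fun b ↦ ?_) (algebraMap_pRadicalClosure_injective R)
  obtain ⟨ν, r, hr⟩ := exists_pow_eq_algebraMap R b
  exact IsIntegral.of_pow (charExponent_pow_pos R ν) (hr ▸ isIntegral_algebraMap)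

/-- The index set of the filtered system of all `R`-subalgebras of the `p`-radical closure that
are finitely generated as `R`-modules, ordered by inclusion. -/
abbrev FiniteIntermediateRing : Type u :=
  {A : Subalgebra R (pRadicalClosure R) // Module.Finite R A}

/-- The normalization of an intermediate ring: its integral closure in its field of fractions. -/
abbrev Normalization {R : Type u} [CommRing R] [IsLocalRing R] [IsNoetherianRing R]
    [IsDomain (FormalCompletion R)] (A : Subalgebra R (pRadicalClosure R)) : Type u :=
  integralClosure A (FractionRing A)

/-- If `R̂` is normal and `t ≠ 0`, then `t ∣ r` holds in `R` as soon as `r / t` is integral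
over `R`. -/
theorem dvd_of_isIntegral [IsIntegrallyClosed (FormalCompletion R)] {K : Type u} [Field K]
    [Algebra R K] (hK : Function.Injective (algebraMap R K)) {x : K} (hx : IsIntegral R x)
    {r t : R} (ht : t ≠ 0) (h : algebraMap R K r = algebraMap R K t * x) : t ∣ r := by
  have := isDomain_of_formalCompletion R
  have hinj := algebraMap_formalCompletion_injective R
  let E := FractionRing (FormalCompletion R)
  have hE : Function.Injective (algebraMap R E) := by
    rw [IsScalarTower.algebraMap_eq R (FormalCompletion R) E]
    exact (IsFractionRing.injective (FormalCompletion R) E).comp hinj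
  let j : FractionRing R →ₐ[R] K :=
    IsFractionRing.liftAlgHom (g := Algebra.ofId R K) hK
  let i : FractionRing R →ₐ[R] E :=
    IsFractionRing.liftAlgHom (g := Algebra.ofId R E) hE
  let y : FractionRing R := algebraMap R _ r / algebraMap R _ t
  have ht' : algebraMap R (FractionRing R) t ≠ 0 := by
    simpa using ht
  have hty : algebraMap R (FractionRing R) r = algebraMap R _ t * y := by
    simp only [y]
    field_simp
  have hjy : j y = x := by
    have h1 := congrArg j hty
    rw [map_mul, AlgHom.commutes, AlgHom.commutes, h] at h1
    exact (mul_left_cancel₀ (by simpa using (map_ne_zero_iff _ hK).mpr ht) h1).symm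
  have hy : IsIntegral R y := by
    rw [← isIntegral_algHom_iff j (RingHom.injective (j : FractionRing R →+* K)), hjy]
    exact hx
  have hiy : IsIntegral (FormalCompletion R) (i y) := (hy.map i).tower_top
  obtain ⟨c, hc⟩ := IsIntegrallyClosed.isIntegral_iff.mp hiy
  have hdvd : algebraMap R (FormalCompletion R) r = algebraMap R _ t * c := by
    apply IsFractionRing.injective (FormalCompletion R) E
    rw [map_mul, hc, ← IsScalarTower.algebraMap_apply, ← IsScalarTower.algebraMap_apply]
    have h1 := congrArg i hty
    rwa [map_mul, AlgHom.commutes, AlgHom.commutes] at h1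
  have : Module.FaithfullyFlat R (FormalCompletion R) :=
    Module.FaithfullyFlat.of_flat_of_isLocalHom
  have hmem : r ∈ ((Ideal.span {t}).map (algebraMap R (FormalCompletion R))).comap
      (algebraMap R (FormalCompletion R)) := by
    rw [Ideal.mem_comap, Ideal.map_span, Set.image_singleton, Ideal.mem_span_singleton]
    exact ⟨c, hdvd⟩
  rwa [Ideal.comap_map_eq_self_of_faithfullyFlat, Ideal.mem_span_singleton] at hmem

/-- If `R̂` is normal, then the normalization of a domain `A ⊇ R` is local as soon as each element
of `A` has a `p`-power in `R`. -/
theorem isLocalRing_normalization_of_pow_mem_range [IsIntegrallyClosed (FormalCompletion R)]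
    (A : Type u) [CommRing A] [IsDomain A] [Algebra R A]
    (hA : Function.Injective (algebraMap R A))
    (hpow : ∀ a : A, ∃ (ν : ℕ) (r : R), algebraMap R A r = a ^ charExponent R ^ ν) :
    IsLocalRing (integralClosure A (FractionRing A)) := by
  have := isDomain_of_formalCompletion R
  have hAK := IsFractionRing.injective A (FractionRing A)
  have hK : Function.Injective (algebraMap R (FractionRing A)) := by
    rw [IsScalarTower.algebraMap_eq R A (FractionRing A)]
    exact hAK.comp hA
  have hint : Algebra.IsIntegral R A := ⟨fun a ↦ by
    obtain ⟨ν, r, hr⟩ := hpow a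
    exact IsIntegral.of_pow (charExponent_pow_pos R ν) (hr ▸ isIntegral_algebraMap)⟩
  refine isLocalRing_of_pow_mem_range (R := R) fun b ↦ ?_
  obtain ⟨a, s, hs, hb⟩ := IsFractionRing.div_surjective (A := A) (b : FractionRing A)
  have hs0 : s ≠ 0 := nonZeroDivisors.ne_zero hs
  obtain ⟨m, r, hr⟩ := hpow a
  obtain ⟨n, t, htt⟩ := hpow s
  set p := charExponent R
  have hpn := charExponent_pow_pos R n
  have hpm := charExponent_pow_pos R m
  have ht0 : t ^ p ^ m ≠ 0 := by
    refine pow_ne_zero _ fun h0 ↦ ?_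
    rw [h0, map_zero] at htt
    exact pow_ne_zero _ hs0 htt.symm
  have hbint : IsIntegral R (b : FractionRing A) := isIntegral_trans _ b.2
  have hmul : algebraMap R (FractionRing A) (r ^ p ^ n)
      = algebraMap R (FractionRing A) (t ^ p ^ m) * (b : FractionRing A) ^ (p ^ m * p ^ n) := by
    have hsb : algebraMap A (FractionRing A) a = algebraMap A _ s * (b : FractionRing A) := by
      rw [← hb, mul_div_cancel₀]
      exact (map_ne_zero_iff _ hAK).mpr hs0
    have h1 : algebraMap R (FractionRing A) r = algebraMap A _ a ^ p ^ m := by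
      rw [IsScalarTower.algebraMap_apply R A (FractionRing A), hr, map_pow]
    have h2 : algebraMap R (FractionRing A) t = algebraMap A _ s ^ p ^ n := by
      rw [IsScalarTower.algebraMap_apply R A (FractionRing A), htt, map_pow]
    rw [map_pow, map_pow, h1, h2, ← pow_mul, ← pow_mul, hsb, mul_pow,
      mul_comm (p ^ n) (p ^ m)]
  obtain ⟨c, hc⟩ := dvd_of_isIntegral R hK (hbint.pow _) ht0 hmul
  refine ⟨p ^ m * p ^ n, Nat.mul_pos hpm hpn, c, Subtype.ext ?_⟩
  rw [hc, map_mul] at hmul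
  exact mul_left_cancel₀ ((map_ne_zero_iff _ hK).mpr ht0) hmul

instance instIsLocalRingNormalization [IsIntegrallyClosed (FormalCompletion R)]
    (A : Subalgebra R (pRadicalClosure R)) : IsLocalRing (Normalization A) :=
  isLocalRing_normalization_of_pow_mem_range R A
    (fun _ _ h ↦ algebraMap_pRadicalClosure_injective R (congrArg Subtype.val h))
    (fun a ↦ by
      obtain ⟨ν, r, hr⟩ := exists_pow_eq_algebraMap R a.1
      exact ⟨ν, r, Subtype.ext hr⟩)

/-- The set of those finite intermediate rings whose normalization is noetherian with reduced
generic formal fibre. -/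
def goodIndices [IsIntegrallyClosed (FormalCompletion R)] : Set (FiniteIntermediateRing R) :=
  {A | IsNoetherianRing (Normalization A.1) ∧ HasReducedGenericFormalFiber (Normalization A.1)}

end

end PRadical

end

open IsLocalRing TensorProduct

namespace PRadical

universe u

/-! Everything follows from flatness of `R̂` over `R^prc`. By the equational criterion it suffices
to trivialize one relation at a time; its finitely many coefficients lie in a good `A`. Let `S` be
the normalization of `A`: since `R̂` is normal, `S` maps to `R̂` and a single power `N` carries `S`
into `R`. The retraction `Ŝ → R̂` of `R̂ → Ŝ` is onto, and its kernel is killed by `N`-th powers,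
hence zero because `Ŝ` is reduced. So `R̂ ≅ Ŝ` is flat over the noetherian ring `S`
(`flat_of_isReduced_formalCompletion`), and the relation is already trivial over the image of `S`,
which lies in `R^prc`.

Faithfully flat descent along `R^prc → R̂` then gives flatness over `R`, the equality of `𝔪_R R^prc`
with the maximal ideal, and the isomorphism of completions. For noetherianity, reduced formal fibres
make `qR̂` radical for each prime `q` of `R`; contracting, `qR^prc` is radical, so every prime of
`R^prc` is extended from `R` (`isNoetherianRing_of_isRadical_map`). -/

/-! ### Reduced formal fibres and reduced completions -/

/-- If `S ⊗ κ(q)` is reduced and `S` is flat over `R`, then the extension of `q` to `S` is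
a radical ideal. -/
theorem isRadical_map_of_isReduced_fiber {R S : Type*} [CommRing R] [CommRing S] [Algebra R S]
    [Module.Flat R S] (q : Ideal R) [q.IsPrime] [IsReduced (q.Fiber S)] :
    (q.map (algebraMap R S)).IsRadical := by
  rintro x ⟨n, hn⟩
  have hmk (y : S) : y ∈ q.map (algebraMap R S) ↔ y ⊗ₜ[R] (1 : R ⧸ q) = 0 := by
    rw [← Algebra.TensorProduct.quotIdealMapEquivTensorQuot_mk, map_eq_zero_iff _
      (AlgEquiv.injective _), Ideal.Quotient.eq_zero_iff_mem]
  let g : (R ⧸ q) →ₐ[R] q.ResidueField := IsScalarTower.toAlgHom R _ _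
  -- Flatness embeds `S/qS = S ⊗ R/q` into the fibre `S ⊗ κ(q)`.
  have hg : Function.Injective (Algebra.TensorProduct.map (AlgHom.id R S) g) :=
    Module.Flat.lTensor_preserves_injective_linearMap g.toLinearMap
      (Ideal.injective_algebraMap_quotient_residueField q)
  have : IsReduced (S ⊗[R] q.ResidueField) :=
    isReduced_of_injective (Algebra.TensorProduct.comm R S q.ResidueField)
      (AlgEquiv.injective _)
  have : IsReduced (S ⊗[R] (R ⧸ q)) := isReduced_of_injective _ hg
  rw [hmk] at hn ⊢
  refine IsReduced.eq_zero _ ⟨n, ?_⟩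
  rw [Algebra.TensorProduct.tmul_pow, one_pow, hn]

/-- If all formal fibres along minimal primes of a noetherian local domain are reduced,
then its formal completion is reduced. -/
theorem isReduced_formalCompletion {S : Type u} [CommRing S] [IsLocalRing S] [IsDomain S]
    [IsNoetherianRing S] (h : HasReducedGenericFormalFiber S) :
    IsReduced (FormalCompletion S) := by
  have := h ⊥ (by simp [IsDomain.minimalPrimes_eq_singleton_bot])
  have h1 := isRadical_map_of_isReduced_fiber (S := FormalCompletion S) (⊥ : Ideal S)
  rw [Ideal.map_bot] at h1
  exact ⟨fun x hx ↦ h1 (hx.imp fun _ h0 ↦ h0)⟩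

/-- If the formal completion of a local domain is reduced, then the generic formal fibre
is reduced. -/
theorem hasReducedGenericFormalFiber_of_isReduced {S : Type u} [CommRing S] [IsLocalRing S]
    [IsDomain S] [IsReduced (FormalCompletion S)] : HasReducedGenericFormalFiber S := by
  intro q _ hq
  obtain rfl : q = ⊥ := by simpa [IsDomain.minimalPrimes_eq_singleton_bot] using hq
  let := Algebra.TensorProduct.rightAlgebra (R := S) (A := (⊥ : Ideal S).ResidueField)
    (B := FormalCompletion S)
  -- As `κ(0) = Frac S`, the fibre is the localization of `Ŝ` at the nonzero elements of `S`.
  exact isReduced_localizationPreserves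
    (Algebra.algebraMapSubmonoid (FormalCompletion S) (nonZeroDivisors S)) _ inferInstance

theorem evalₐ_formalCompletionMap {R A : Type u} [CommRing R] [IsLocalRing R] [CommRing A]
    [IsLocalRing A] (φ : R →+* A) [IsLocalHom φ] (n : ℕ) (x : FormalCompletion R) :
    AdicCompletion.evalₐ (maximalIdeal A) n (formalCompletionMap φ x) =
      Ideal.quotientMap (maximalIdeal A ^ n) φ (maximalIdeal_pow_le_comap φ n)
        (AdicCompletion.evalₐ (maximalIdeal R) n x) := by
  unfold formalCompletionMap
  generalize_proofs
  rename_i h _ _ _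
  exact AdicCompletion.evalₐ_liftRingHom _ _ h n x

/-! ### The retraction of completions induced by a local map to `R̂` -/

section Retraction

variable (R : Type u) [CommRing R] [IsLocalRing R] [IsNoetherianRing R]
  (S : Type u) [CommRing S] [IsLocalRing S] [Algebra S (FormalCompletion R)]
  [IsLocalHom (algebraMap S (FormalCompletion R))]

variable {R} in
theorem evalₐ_eq_zero_iff (n : ℕ) (x : FormalCompletion R) :
    AdicCompletion.evalₐ (maximalIdeal R) n x = 0 ↔
      x ∈ (maximalIdeal R ^ n).map (algebraMap R (FormalCompletion R)) := by
  -- That the kernel of evaluation is the extended ideal rests on `𝔪_R` being finitely generated.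
  have h := AdicCompletion.pow_smul_top_eq_ker_eval (M := R) (n := n)
    (maximalIdeal R).fg_of_isNoetherianRing
  have hle : maximalIdeal R ^ n • ⊤ ≤ maximalIdeal R ^ n := (Ideal.mul_top _).le
  have hinj : Function.Injective (Ideal.Quotient.factor hle) := by
    rw [RingHom.injective_iff_ker_eq_bot, Ideal.Quotient.factor_ker]
    exact Ideal.map_mk_eq_bot_of_le (Ideal.mul_top _).ge
  rw [← AdicCompletion.factor_eval_eq_evalₐ _ _ hle]
  refine (map_eq_zero_iff _ hinj).trans ?_
  rw [← Submodule.restrictScalars_mem R, ← Ideal.smul_top_eq_map]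
  exact (SetLike.ext_iff.mp h x).symm

theorem evalₐ_algebraMap_eq_zero {n : ℕ} {s : S} (hs : s ∈ maximalIdeal S ^ n) :
    AdicCompletion.evalₐ (maximalIdeal R) n (algebraMap S (FormalCompletion R) s) = 0 := by
  rw [evalₐ_eq_zero_iff, Ideal.map_pow, ← AdicCompletion.maximalIdeal_eq_map]
  exact maximalIdeal_pow_le_comap (algebraMap S (FormalCompletion R)) n hs

/-- The map `S / 𝔪_S ^ n → R / 𝔪_R ^ n` induced by a local homomorphism `S → R̂`. -/
noncomputable def quotientRetraction (n : ℕ) : S ⧸ maximalIdeal S ^ n →+* R ⧸ maximalIdeal R ^ n :=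
  Ideal.Quotient.lift _ ((AdicCompletion.evalₐ (maximalIdeal R) n).toRingHom.comp
    (algebraMap S (FormalCompletion R))) fun _ hs ↦ evalₐ_algebraMap_eq_zero R S hs

@[simp]
theorem quotientRetraction_mk (n : ℕ) (s : S) :
    quotientRetraction R S n (Ideal.Quotient.mk _ s) =
      AdicCompletion.evalₐ (maximalIdeal R) n (algebraMap S (FormalCompletion R) s) :=
  rfl

/-- The map `Ŝ → R̂` induced by a local homomorphism `S → R̂`. -/
noncomputable def retraction : FormalCompletion S →+* FormalCompletion R :=
  AdicCompletion.liftRingHom (maximalIdeal R)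
    (fun n ↦ (quotientRetraction R S n).comp
      (AdicCompletion.evalₐ (maximalIdeal S) n).toRingHom)
    (by
      intro m n hle
      ext x
      obtain ⟨y, rfl⟩ := AdicCompletion.mk_surjective (maximalIdeal S) S x
      have h := congrArg (quotientRetraction R S m)
        (AdicCompletion.Ideal.mk_eq_mk (maximalIdeal S) hle y)
      obtain ⟨z, hz⟩ := AdicCompletion.mk_surjective (maximalIdeal R) R
        (algebraMap S (FormalCompletion R) (y n))
      have h2 := AdicCompletion.Ideal.mk_eq_mk (maximalIdeal R) hle z
      simp only [quotientRetraction_mk, ← hz, AdicCompletion.evalₐ_mk] at h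
      simp [← hz, ← h, ← h2])

@[simp]
theorem evalₐ_retraction (n : ℕ) (x : FormalCompletion S) :
    AdicCompletion.evalₐ (maximalIdeal R) n (retraction R S x) =
      quotientRetraction R S n (AdicCompletion.evalₐ (maximalIdeal S) n x) := by
  unfold retraction
  generalize_proofs
  rename_i h
  exact AdicCompletion.evalₐ_liftRingHom _ _ h n x

theorem retraction_algebraMap (s : S) :
    retraction R S (algebraMap S (FormalCompletion S) s) =
      algebraMap S (FormalCompletion R) s :=
  AdicCompletion.ext_evalₐ fun n ↦ by simp

variable {R S} in
theorem retraction_injective_of_forall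
    (h : ∀ (n : ℕ) (s : S),
      AdicCompletion.evalₐ (maximalIdeal R) n (algebraMap S (FormalCompletion R) s) = 0 →
        s ∈ maximalIdeal S ^ n) :
    Function.Injective (retraction R S) := by
  refine (injective_iff_map_eq_zero _).mpr fun y hy ↦ AdicCompletion.ext_evalₐ fun n ↦ ?_
  obtain ⟨s, hs⟩ := Ideal.Quotient.mk_surjective (AdicCompletion.evalₐ (maximalIdeal S) n y)
  have h1 := evalₐ_retraction R S n y
  rw [hy, map_zero, ← hs, quotientRetraction_mk] at h1
  rw [map_zero, ← hs, Ideal.Quotient.eq_zero_iff_mem]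
  exact h n s h1.symm

variable [Algebra R S] [IsScalarTower R S (FormalCompletion R)]

theorem retraction_formalCompletionMap [IsLocalHom (algebraMap R S)] (x : FormalCompletion R) :
    retraction R S (formalCompletionMap (algebraMap R S) x) = x := by
  refine AdicCompletion.ext_evalₐ fun n ↦ ?_
  obtain ⟨r, hr⟩ := Ideal.Quotient.mk_surjective (AdicCompletion.evalₐ (maximalIdeal R) n x)
  rw [evalₐ_retraction, evalₐ_formalCompletionMap, ← hr, Ideal.quotientMap_mk,
    quotientRetraction_mk, ← IsScalarTower.algebraMap_apply, AlgHom.commutes,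
    Ideal.Quotient.algebraMap_eq]

/-- If the retraction `Ŝ → R̂` is injective, then `R̂ → Ŝ` is bijective. -/
theorem formalCompletionMap_bijective [IsLocalHom (algebraMap R S)]
    (h : Function.Injective (retraction R S)) :
    Function.Bijective (formalCompletionMap (algebraMap R S)) :=
  ⟨Function.LeftInverse.injective (retraction_formalCompletionMap R S), fun y ↦
    ⟨retraction R S y, h (retraction_formalCompletionMap R S _)⟩⟩

-- At level `n`, a representative `s` of `y` dies in `R / 𝔪_R ^ n`, so `s ^ N`, which comes from
-- `R`, comes from `𝔪_R ^ n` and lies in `𝔪_S ^ n`. The exponent must not depend on `n`, hence the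
-- need for a uniform `N`.
variable {R S} in
theorem pow_eq_zero_of_retraction_eq_zero [IsLocalHom (algebraMap R S)] {N : ℕ} (hN : N ≠ 0)
    (hpow : ∀ s : S, ∃ r : R, algebraMap R S r = s ^ N) {y : FormalCompletion S}
    (hy : retraction R S y = 0) : y ^ N = 0 := by
  refine AdicCompletion.ext_evalₐ fun n ↦ ?_
  obtain ⟨s, hs⟩ := Ideal.Quotient.mk_surjective (AdicCompletion.evalₐ (maximalIdeal S) n y)
  have h1 := evalₐ_retraction R S n y
  rw [hy, map_zero, ← hs, quotientRetraction_mk] at h1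
  obtain ⟨r, hr⟩ := hpow s
  have h2 : AdicCompletion.evalₐ (maximalIdeal R) n (algebraMap R (FormalCompletion R) r) = 0 := by
    rw [IsScalarTower.algebraMap_apply R S, hr, map_pow, map_pow, ← h1, zero_pow hN]
  rw [AlgHom.commutes, Ideal.Quotient.algebraMap_eq, Ideal.Quotient.eq_zero_iff_mem] at h2
  rw [map_zero, map_pow, ← hs, ← map_pow, Ideal.Quotient.eq_zero_iff_mem, ← hr]
  exact maximalIdeal_pow_le_comap _ n h2

/-- Let `S` be a noetherian local ring with `R ⊆ S → R̂` such that `N`-th powers of elements of `S`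
belong to `R`. If `Ŝ` is reduced, then `R̂` is flat over `S`. -/
theorem flat_of_isReduced_formalCompletion [IsNoetherianRing S] [IsLocalHom (algebraMap R S)]
    [IsReduced (FormalCompletion S)] {N : ℕ} (hN : N ≠ 0)
    (hpow : ∀ s : S, ∃ r : R, algebraMap R S r = s ^ N) :
    Module.Flat S (FormalCompletion R) := by
  have hinj : Function.Injective (retraction R S) :=
    (injective_iff_map_eq_zero _).mpr fun y hy ↦
      IsReduced.eq_zero y ⟨N, pow_eq_zero_of_retraction_eq_zero hN hpow hy⟩
  let f : FormalCompletion S →ₐ[S] FormalCompletion R :=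
    { retraction R S with commutes' := retraction_algebraMap R S }
  have hf : Function.Bijective f :=
    ⟨hinj, fun x ↦ ⟨formalCompletionMap (algebraMap R S) x, retraction_formalCompletionMap R S x⟩⟩
  exact Module.Flat.of_linearEquiv (AlgEquiv.ofBijective f hf).symm.toLinearEquiv

end Retraction

/-! ### Uniform exponents and normalizations inside `R̂` -/

/-- If `B` is a finite `R`-algebra of characteristic exponent `p` all of whose elements have
a `p`-power in `R`, then the exponent can be chosen uniformly. -/
theorem exists_forall_pow_mem_range {R B : Type*} [CommRing R] [CommRing B] [Algebra R B]
    [Module.Finite R B] (p : ℕ) [ExpChar B p]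
    (h : ∀ b : B, ∃ (ν : ℕ) (r : R), algebraMap R B r = b ^ p ^ ν) :
    ∃ ν : ℕ, ∀ b : B, ∃ r : R, algebraMap R B r = b ^ p ^ ν := by
  choose e he using h
  obtain ⟨s, hs⟩ := Module.Finite.fg_top (R := R) (M := B)
  refine ⟨s.sup e, fun b ↦ ?_⟩
  have hb : b ∈ Submodule.span R (s : Set B) := hs ▸ Submodule.mem_top
  -- Frobenius is additive, so the largest exponent among the generators serves all of `B`.
  induction hb using Submodule.span_induction with
  | mem x hx =>
    obtain ⟨r, hr⟩ := he x
    refine ⟨r ^ p ^ (s.sup e - e x), ?_⟩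
    rw [map_pow, hr, ← pow_mul, ← pow_add, Nat.add_sub_cancel' (Finset.le_sup hx)]
  | zero => exact ⟨0, by rw [map_zero, zero_pow (expChar_pow_pos B p _).ne']⟩
  | add x y _ _ hx hy =>
    obtain ⟨r, hr⟩ := hx
    obtain ⟨t, ht⟩ := hy
    exact ⟨r + t, by rw [map_add, hr, ht, add_pow_expChar_pow]⟩
  | smul c x _ hx =>
    obtain ⟨r, hr⟩ := hx
    exact ⟨c ^ p ^ s.sup e * r, by rw [map_mul, map_pow, hr, Algebra.smul_def, mul_pow]⟩

/-- The inclusion of a domain `A` in an integrally closed domain extends to the integral closure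
of `A` in its field of fractions. -/
theorem exists_integralClosure_algHom {R A T : Type*} [CommRing R] [CommRing A] [IsDomain A]
    [CommRing T] [IsDomain T] [IsIntegrallyClosed T] [Algebra R A] [Algebra R T] (j : A →ₐ[R] T)
    (hj : Function.Injective j) :
    ∃ ι : integralClosure A (FractionRing A) →ₐ[R] T, ∀ a : A, ∃ s, ι s = j a := by
  let := j.toRingHom.toAlgebra
  let E := FractionRing T
  have hE : Function.Injective (algebraMap A E) := by
    rw [IsScalarTower.algebraMap_eq A T E]
    exact (IsFractionRing.injective T E).comp hj
  let i : FractionRing A →ₐ[A] E := IsFractionRing.liftAlgHom (g := Algebra.ofId A E) hE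
  -- The image of `s` in `Frac T` is integral over `T`, hence lies in `T`.
  have hi (s : integralClosure A (FractionRing A)) : ∃ t : T, algebraMap T E t = i s :=
    IsIntegrallyClosed.isIntegral_iff.mp ((s.2.map i).tower_top)
  let f : integralClosure A (FractionRing A) →+* (algebraMap T E).range :=
    (i.toRingHom.comp (algebraMap _ (FractionRing A))).codRestrict _ fun s ↦ hi s
  let e : T ≃+* (algebraMap T E).range :=
    RingEquiv.ofBijective (algebraMap T E).rangeRestrict
      ⟨fun x y h ↦ IsFractionRing.injective T E (congrArg Subtype.val h),
        RingHom.rangeRestrict_surjective _⟩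
  have key (a : A) : e.symm (f (algebraMap A _ a)) = j a := by
    refine (RingEquiv.symm_apply_eq e).mpr (Subtype.ext ?_)
    change i (algebraMap A (FractionRing A) a) = algebraMap T E (algebraMap A T a)
    rw [AlgHom.commutes, ← IsScalarTower.algebraMap_apply]
  exact ⟨{ e.symm.toRingHom.comp f with
    commutes' := fun r ↦ (key (algebraMap R A r)).trans (j.commutes r) }, fun a ↦ ⟨_, key a⟩⟩

/-! ### Flatness of `R̂` over `R^prc` -/

section

variable (R : Type u) [CommRing R] [IsLocalRing R] [IsNoetherianRing R]

theorem isLocalHom_algebraMap_of_pow_mem {S : Type u} [CommRing S] [Algebra R S]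
    [Algebra S (FormalCompletion R)] [IsScalarTower R S (FormalCompletion R)]
    (hpow : ∀ s : S, ∃ N : ℕ, N ≠ 0 ∧ ∃ r : R, algebraMap R S r = s ^ N) :
    IsLocalHom (algebraMap S (FormalCompletion R)) := by
  refine ⟨fun s hs ↦ ?_⟩
  obtain ⟨N, hN, r, hr⟩ := hpow s
  have h1 : IsUnit (algebraMap R (FormalCompletion R) r) := by
    rw [IsScalarTower.algebraMap_apply R S, hr, map_pow]
    exact hs.pow N
  have h2 := (isUnit_of_map_unit _ r h1).map (algebraMap R S)
  rw [hr] at h2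
  exact (isUnit_pow_iff hN).mp h2

variable [IsDomain (FormalCompletion R)]

variable {R}

/-- Let `S` be a noetherian local `R`-algebra with reduced completion, mapping to `R̂`, such that
`p ^ ν`-th powers of elements of `S` belong to `R`. Then each relation over `R^prc` between elements
of `R̂` with coefficients in the image of `S` is trivial. -/
theorem isTrivialRelation_of_isReduced_formalCompletion {S : Type u} [CommRing S] [IsLocalRing S]
    [IsNoetherianRing S] [Algebra R S] [IsReduced (FormalCompletion S)]
    (ι : S →ₐ[R] FormalCompletion R) {ν : ℕ}
    (hν : ∀ s : S, ∃ r : R, algebraMap R S r = s ^ charExponent R ^ ν)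
    {l : ℕ} {f : Fin l → pRadicalClosure R} {x : Fin l → FormalCompletion R}
    (hf : ∀ i, ∃ s : S, ι s = f i) (h : ∑ i, f i • x i = 0) :
    Module.IsTrivialRelation f x := by
  have hN := (charExponent_pow_pos R ν).ne'
  let := ι.toRingHom.toAlgebra
  have : IsScalarTower R S (FormalCompletion R) := .of_algebraMap_eq fun r ↦ (ι.commutes r).symm
  have := isLocalHom_algebraMap_of_pow_mem R (S := S) fun s ↦ ⟨_, hN, hν s⟩
  have : IsLocalHom (algebraMap R S) := by
    have : IsLocalHom ((algebraMap S (FormalCompletion R)).comp (algebraMap R S)) := by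
      rw [← IsScalarTower.algebraMap_eq]
      infer_instance
    exact isLocalHom_of_comp _ (algebraMap S (FormalCompletion R))
  have := flat_of_isReduced_formalCompletion R S hN hν
  choose g hg using hf
  replace hg (i) : algebraMap S (FormalCompletion R) (g i) = f i := hg i
  obtain ⟨k, a, y, hxy, hga⟩ := Module.Flat.isTrivialRelation_of_sum_smul_eq_zero
    (f := g) (x := x) (by
      simp only [Algebra.smul_def, hg]
      exact h)
  -- This lets the trivializing coefficients, found over `S`, be read in `R^prc`.
  have hmem (s : S) : algebraMap S (FormalCompletion R) s ∈ pRadicalClosure R := by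
    obtain ⟨r, hr⟩ := hν s
    exact ⟨ν, r, by rw [IsScalarTower.algebraMap_apply R S, hr, map_pow]⟩
  refine ⟨k, fun i j ↦ ⟨_, hmem (a i j)⟩, y, hxy, fun j ↦ Subtype.ext ?_⟩
  have h1 := congrArg (algebraMap S (FormalCompletion R)) (hga j)
  rw [map_sum, map_zero] at h1
  simpa [hg] using h1

theorem expChar_subalgebra_pRadicalClosure (A : Subalgebra R (pRadicalClosure R)) :
    ExpChar A (charExponent R) := by
  have := expChar_formalCompletion R
  exact (((pRadicalClosure R).val.comp A.val).toRingHom.expChar_iff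
    (Subtype.val_injective.comp Subtype.val_injective) _).mpr this

variable [IsIntegrallyClosed (FormalCompletion R)]

variable (R) in
/-- If `A` is a finite `R`-algebra and a domain all of whose elements have a `p`-power in `R`, then
the normalization of `A` has the same property, with a uniform exponent. -/
theorem exists_forall_pow_mem_range_integralClosure (A : Type u) [CommRing A] [IsDomain A]
    [Algebra R A] [Module.Finite R A] [ExpChar A (charExponent R)]
    (hA : Function.Injective (algebraMap R A))
    (hpow : ∀ a : A, ∃ (ν : ℕ) (r : R), algebraMap R A r = a ^ charExponent R ^ ν) :
    ∃ ν : ℕ, ∀ s : integralClosure A (FractionRing A), ∃ r : R,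
      algebraMap R (integralClosure A (FractionRing A)) r = s ^ charExponent R ^ ν := by
  have hAK := IsFractionRing.injective A (FractionRing A)
  have hK : Function.Injective (algebraMap R (FractionRing A)) := by
    rw [IsScalarTower.algebraMap_eq R A (FractionRing A)]
    exact hAK.comp hA
  -- The normalization is not known to be finite over `R`, so the exponent is taken from `A`; it
  -- passes to fractions, and integrality of `r / t` puts the power back in `R`.
  obtain ⟨ν, hν⟩ := exists_forall_pow_mem_range (charExponent R) hpow
  have hint : Algebra.IsIntegral R A := inferInstance
  refine ⟨ν, fun s ↦ ?_⟩
  obtain ⟨a, b, hb, hs⟩ := IsFractionRing.div_surjective (A := A) (s : FractionRing A)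
  have hb0 : b ≠ 0 := nonZeroDivisors.ne_zero hb
  obtain ⟨r, hr⟩ := hν a
  obtain ⟨t, ht⟩ := hν b
  have ht0 : t ≠ 0 := by
    rintro rfl
    rw [map_zero] at ht
    exact pow_ne_zero _ hb0 ht.symm
  have hsint : IsIntegral R (s : FractionRing A) := isIntegral_trans _ s.2
  have hmul : algebraMap R (FractionRing A) r =
      algebraMap R (FractionRing A) t * (s : FractionRing A) ^ charExponent R ^ ν := by
    rw [IsScalarTower.algebraMap_apply R A _ r, IsScalarTower.algebraMap_apply R A _ t, hr, ht, map_pow,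
      map_pow, ← mul_pow, ← hs, mul_div_cancel₀]
    exact (map_ne_zero_iff _ hAK).mpr hb0
  obtain ⟨c, rfl⟩ := dvd_of_isIntegral R hK (hsint.pow _) ht0 hmul
  refine ⟨c, Subtype.ext ?_⟩
  rw [map_mul] at hmul
  exact mul_left_cancel₀ ((map_ne_zero_iff _ hK).mpr ht0) hmul

/-- Each relation over `R^prc` between elements of `R̂` with coefficients in a good intermediate
ring is trivial. -/
theorem isTrivialRelation_of_mem_goodIndices {A : FiniteIntermediateRing R}
    (hA : A ∈ goodIndices R) {l : ℕ} {f : Fin l → pRadicalClosure R}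
    {x : Fin l → FormalCompletion R} (hf : ∀ i, f i ∈ A.1) (h : ∑ i, f i • x i = 0) :
    Module.IsTrivialRelation f x := by
  have : Module.Finite R A.1 := A.2
  have : IsNoetherianRing (Normalization A.1) := hA.1
  have := isReduced_formalCompletion hA.2
  have := expChar_subalgebra_pRadicalClosure A.1
  obtain ⟨ν, hν⟩ := exists_forall_pow_mem_range_integralClosure R A.1
    (fun _ _ h ↦ algebraMap_pRadicalClosure_injective R (congrArg Subtype.val h)) fun a ↦ by
      obtain ⟨ν, r, hr⟩ := exists_pow_eq_algebraMap R a.1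
      exact ⟨ν, r, Subtype.ext hr⟩
  obtain ⟨ι, hι⟩ := exists_integralClosure_algHom ((pRadicalClosure R).val.comp A.1.val)
    (Subtype.val_injective.comp Subtype.val_injective)
  exact isTrivialRelation_of_isReduced_formalCompletion ι hν (fun i ↦ hι ⟨f i, hf i⟩) h

theorem flat_pRadicalClosure_formalCompletion (hcof : IsCofinal (goodIndices R)) :
    Module.Flat (pRadicalClosure R) (FormalCompletion R) := by
  refine Module.Flat.of_forall_isTrivialRelation fun {l f x} h ↦ ?_
  have hfin : Module.Finite R (Algebra.adjoin R (Set.range f)) := by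
    refine ⟨(Submodule.fg_top _).mpr
      (fg_adjoin_of_finite (Set.finite_range f) fun b _ ↦ ?_)⟩
    obtain ⟨ν, r, hr⟩ := exists_pow_eq_algebraMap R b
    exact IsIntegral.of_pow (charExponent_pow_pos R ν) (hr ▸ isIntegral_algebraMap)
  obtain ⟨A, hA, hle⟩ := hcof (⟨Algebra.adjoin R (Set.range f), hfin⟩ : FiniteIntermediateRing R)
  exact isTrivialRelation_of_mem_goodIndices hA
    (fun i ↦ hle (Algebra.subset_adjoin (Set.mem_range_self i))) h

end

/-! ### Descent of flatness and noetherianity -/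

/-- If `R → S → T` are ring homomorphisms such that `T` is flat over `R` and faithfully flat
over `S`, then `S` is flat over `R`. -/
theorem flat_of_faithfullyFlat_of_flat (R S T : Type u) [CommRing R] [CommRing S] [CommRing T]
    [Algebra R S] [Algebra S T] [Algebra R T] [IsScalarTower R S T] [Module.FaithfullyFlat S T]
    [Module.Flat R T] : Module.Flat R S := by
  rw [Module.Flat.iff_lTensor_preserves_injective_linearMap]
  intro N Q _ _ _ _ f hf
  have h := Module.Flat.lTensor_preserves_injective_linearMap (M := T) f hf
  -- Injectivity is tested after `T ⊗[S] -`, where `T ⊗[S] (S ⊗[R] f)` is identified with `T ⊗[R]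
  -- f`.
  refine (Module.FaithfullyFlat.lTensor_injective_iff_injective S T
    (AlgebraTensorModule.lTensor S S f)).mp ?_
  have h1 := AlgebraTensorModule.lTensor_comp_cancelBaseChange R S S (M := T) f
  refine Function.Injective.of_comp
    (f := AlgebraTensorModule.cancelBaseChange R S S T Q) fun x y hxy ↦ ?_
  have h2 (z) := LinearMap.congr_fun h1 z
  exact (AlgebraTensorModule.cancelBaseChange R S S T N).injective
    (h ((h2 x).trans (Eq.trans hxy (h2 y).symm)))

/-- Let `S` be an `R`-algebra and `T` a faithfully flat `S`-algebra. If the extension to `T` of each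
prime ideal of `R` is radical and each element of `S` has a power in `R`, then `S` is noetherian. -/
theorem isNoetherianRing_of_isRadical_map {R S T : Type*} [CommRing R] [IsNoetherianRing R]
    [CommRing S] [CommRing T] [Algebra R S] [Algebra S T] [Algebra R T] [IsScalarTower R S T]
    [Module.FaithfullyFlat S T]
    (hrad : ∀ q : Ideal R, q.IsPrime → (q.map (algebraMap R T)).IsRadical)
    (hpow : ∀ s : S, ∃ N : ℕ, N ≠ 0 ∧ ∃ r : R, algebraMap R S r = s ^ N) : IsNoetherianRing S := by
  -- Cohen's criterion: only primes need be finitely generated.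
  refine IsNoetherianRing.of_prime fun Q hQ ↦ ?_
  suffices h : Q = (Q.comap (algebraMap R S)).map (algebraMap R S) from
    h ▸ Ideal.FG.map (IsNoetherian.noetherian (Q.comap (algebraMap R S))) _
  refine le_antisymm (fun s hs ↦ ?_) Ideal.map_comap_le
  obtain ⟨N, hN, r, hr⟩ := hpow s
  rw [← Ideal.comap_map_eq_self_of_faithfullyFlat (B := T)
    ((Q.comap (algebraMap R S)).map (algebraMap R S)), Ideal.mem_comap, Ideal.map_map,
    ← IsScalarTower.algebraMap_eq]
  refine hrad _ (hQ.comap _) ⟨N, ?_⟩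
  rw [← map_pow, ← hr, ← IsScalarTower.algebraMap_apply]
  refine Ideal.mem_map_of_mem _ ?_
  rw [Ideal.mem_comap, hr]
  exact Ideal.pow_mem_of_mem Q hs N (Nat.pos_of_ne_zero hN)

/-! ### Residue field, maximal ideal and completion of a ring between `R` and `R̂` -/

section

variable {R : Type u} [CommRing R] [IsLocalRing R] [IsNoetherianRing R]
variable {S : Type u} [CommRing S] [IsLocalRing S] [Algebra R S] [IsLocalHom (algebraMap R S)]
  [Algebra S (FormalCompletion R)] [IsScalarTower R S (FormalCompletion R)]

-- Some `r` in `R` agrees with `s` modulo `𝔪_R R̂`; were `r - s` a unit of `S`, the maximal ideal of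
-- `R̂` would contain a unit.
variable (R S) in
theorem residueField_map_surjective :
    Function.Surjective (algebraMap (ResidueField R) (ResidueField S)) := by
  intro x
  obtain ⟨s, rfl⟩ := residue_surjective x
  obtain ⟨r, hr⟩ := Ideal.Quotient.mk_surjective
    (AdicCompletion.evalₐ (maximalIdeal R) 1 (algebraMap S (FormalCompletion R) s))
  refine ⟨residue R r, ?_⟩
  change residue S (algebraMap R S r) = residue S s
  rw [← sub_eq_zero, ← map_sub, residue_eq_zero_iff, mem_maximalIdeal]
  refine fun h ↦ ?_
  have h1 : AdicCompletion.evalₐ (maximalIdeal R) 1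
      (algebraMap S (FormalCompletion R) (algebraMap R S r - s)) = 0 := by
    rw [map_sub, map_sub, ← hr, ← IsScalarTower.algebraMap_apply, AlgHom.commutes,
      Ideal.Quotient.algebraMap_eq, sub_self]
  rw [evalₐ_eq_zero_iff, pow_one, ← AdicCompletion.maximalIdeal_eq_map] at h1
  exact h1 (h.map _)

theorem residualDegree_eq_one : residualDegree R S = 1 := by
  rw [residualDegree, Cardinal.toENat_eq_one, ← CommSemiring.rank_self (ResidueField R)]
  exact (LinearEquiv.ofBijective (Algebra.linearMap (ResidueField R) (ResidueField S))
    ⟨RingHom.injective _, residueField_map_surjective R S⟩).rank_eq.symm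

variable [IsLocalHom (algebraMap S (FormalCompletion R))]

/-- The maximal ideal of `S` maps into that of `R̂`, which is `𝔪_R R̂`; faithful flatness contracts
this to `𝔪_R S`. -/
theorem map_maximalIdeal_eq_of_flat [Module.Flat S (FormalCompletion R)] :
    (maximalIdeal R).map (algebraMap R S) = maximalIdeal S := by
  have : Module.FaithfullyFlat S (FormalCompletion R) :=
    Module.FaithfullyFlat.of_flat_of_isLocalHom
  refine le_antisymm (((local_hom_TFAE (algebraMap R S)).out 0 2).mp
    ‹IsLocalHom (algebraMap R S)›) fun s hs ↦ ?_
  rw [← Ideal.comap_map_eq_self_of_faithfullyFlat (B := FormalCompletion R)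
    ((maximalIdeal R).map (algebraMap R S)), Ideal.map_map, ← IsScalarTower.algebraMap_eq,
    ← AdicCompletion.maximalIdeal_eq_map]
  exact map_nonunit (algebraMap S (FormalCompletion R)) s hs

/-- The kernel of `S → R / 𝔪_R ^ n` is the contraction of `𝔪_R ^ n R̂`, that is `𝔪_R ^ n S = 𝔪_S ^
n`, so the retraction is injective at each level. No noetherianity of `S` enters. -/
theorem formalCompletionMap_bijective_of_flat [Module.Flat S (FormalCompletion R)] :
    Function.Bijective (formalCompletionMap (algebraMap R S)) := by
  have : Module.FaithfullyFlat S (FormalCompletion R) :=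
    Module.FaithfullyFlat.of_flat_of_isLocalHom
  refine formalCompletionMap_bijective R S (retraction_injective_of_forall fun n s hs ↦ ?_)
  rwa [evalₐ_eq_zero_iff, IsScalarTower.algebraMap_eq R S, ← Ideal.map_map, ← Ideal.mem_comap,
    Ideal.comap_map_eq_self_of_faithfullyFlat, Ideal.map_pow, map_maximalIdeal_eq_of_flat] at hs

theorem ramificationIndex_eq_one_of_flat [Module.Flat S (FormalCompletion R)] :
    ramificationIndex R S = 1 := by
  rw [ramificationIndex, map_maximalIdeal_eq_of_flat, Module.length_eq_one_iff,
    isSimpleModule_iff_isCoatom]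
  exact (maximalIdeal.isMaximal S).out

end

end PRadical

open PRadical in
theorem theorem3p10 {R : Type*} [CommRing R] [IsLocalRing R] [IsNoetherianRing R]
    [IsDomain (FormalCompletion R)] [IsIntegrallyClosed (FormalCompletion R)]
    (hfib : HasReducedFormalFibers R)
    (hcof : IsCofinal (goodIndices R)) :
    IsNoetherianRing (pRadicalClosure R) ∧
    HasReducedGenericFormalFiber (pRadicalClosure R) ∧
    Module.FaithfullyFlat R (pRadicalClosure R) ∧
    ramificationIndex R (pRadicalClosure R) = 1 ∧
    residualDegree R (pRadicalClosure R) = 1 ∧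
    Function.Bijective (formalCompletionMap (algebraMap R (pRadicalClosure R))) := by
  have hpow (b : pRadicalClosure R) :
      ∃ N : ℕ, N ≠ 0 ∧ ∃ r : R, algebraMap R (pRadicalClosure R) r = b ^ N := by
    obtain ⟨ν, r, hr⟩ := exists_pow_eq_algebraMap R b
    exact ⟨_, (charExponent_pow_pos R ν).ne', r, hr⟩
  have := isLocalHom_algebraMap_of_pow_mem R hpow
  have := flat_pRadicalClosure_formalCompletion hcof
  have : Module.FaithfullyFlat (pRadicalClosure R) (FormalCompletion R) :=
    Module.FaithfullyFlat.of_flat_of_isLocalHom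
  have := flat_of_faithfullyFlat_of_flat R (pRadicalClosure R) (FormalCompletion R)
  have hbij := formalCompletionMap_bijective_of_flat (R := R) (S := pRadicalClosure R)
  -- Reducedness is carried over from the domain `R̂`.
  have : IsReduced (FormalCompletion (pRadicalClosure R)) :=
    isReduced_of_injective (RingEquiv.ofBijective _ hbij).symm (RingEquiv.injective _)
  refine ⟨?_, hasReducedGenericFormalFiber_of_isReduced,
    Module.FaithfullyFlat.of_flat_of_isLocalHom, ramificationIndex_eq_one_of_flat,
    residualDegree_eq_one, hbij⟩
  refine isNoetherianRing_of_isRadical_map (R := R) (T := FormalCompletion R) (fun q hq ↦ ?_) hpow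
  have := hfib q
  exact isRadical_map_of_isReduced_fiber q
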